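/- Let $\mathcal X$ be a set (the possible exact convolution outputs), $\mathcal Y$ a measurable space, and let $\mathcal R$ be a local randomizer, assigning to every $x\in\mathcal X$ the law $\mathcal R(x)$ of a random element of $\mathcal Y$. For laws $P,Q$ write $P\preceq_{\varepsilon,\delta}Q$ if $P(S)\le e^{\varepsilon}Q(S)+\delta$ for every measurable set $S$. The randomizer $\mathcal R$ is $(\varepsilon_0,\delta_0)$-locally differentially private (LDP) if $\mathcal R(x)\preceq_{\varepsilon_0,\delta_0}\mathcal R(x')$ for all $x,x'\in\mathcal X$. A randomized mechanism $\mathcal M$ on $\mathcal X^n$ is $(\varepsilon,\delta)$-differentially private (DP) if $\mathcal M(\mathbf x)\preceq_{\varepsilon,\delta}\mathcal M(\mathbf x')$ for all $\mathbf x,\mathbf x'\in\mathcal X^n$ that differ in at most one entry. In a round of Safhire with $n\ge 1$ exact convolution outputs $x_1,\dots,x_n\in\mathcal X$, the server forms independent noisy outputs $y_i\sim\mathcal R(x_i)$, draws a permutation $\sigma$ of $\{1,\dots,n\}$ uniformly at random and independently of them, and the client observes $(y_{\sigma(1)},\dots,y_{\sigma(n)})$. **Theorem.** Let $\varepsilon_0,\delta_0\ge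 0$ and suppose that $\mathcal R$ is $(\varepsilon_0,\delta_0)$-LDP. Then for every $\delta\in(0,1]$ with $\varepsilon_0\le\ln\left(\frac{n}{16\ln(2/\delta)}\right)$ there is an $\varepsilon$ with $$0\le\varepsilon\le\ln\left(1+\frac{e^{\varepsilon_0}-1}{e^{\varepsilon_0}+1}\left(\frac{8\sqrt{e^{\varepsilon_0}\ln(4/\delta)}}{\sqrt n}+\frac{8e^{\varepsilon_0}}{n}\right)\right)$$ such that the mechanism mapping $(x_1,\dots,x_n)$ to the client's observation $(y_{\sigma(1)},\dots,y_{\sigma(n)})$ is $$\left(\varepsilon,\ \delta+(e^{\varepsilon}+1)\left(\tfrac{e^{-\varepsilon_0}}{2}+1\right)n\,\delta_0\right)\text{-DP}.$$ -/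

import Mathlib

open MeasureTheory

noncomputable section

namespace Safhire

/-- `P` and `Q` satisfy the one-sided `(ε, δ)`-indistinguishability inequality
`P(S) ≤ e^ε Q(S) + δ` for every event `S`. -/
def DPBound {Z : Type*} [MeasurableSpace Z] (ε δ : ℝ) (P Q : Measure Z) : Prop :=
  ∀ S : Set Z, MeasurableSet S →
    P S ≤ ENNReal.ofReal (Real.exp ε) * Q S + ENNReal.ofReal δ

/-- The randomizer `R`, which maps an input `x` to the law `R x` of a random output, is
`(ε, δ)`-locally differentially private: the bound holds for all pairs of inputs. -/
def IsLocallyDP {X Y : Type*} [MeasurableSpace Y] (R : X → Measure Y) (ε δ : ℝ) : Prop :=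
  ∀ x x' : X, DPBound ε δ (R x) (R x')

/-- Two `n`-tuples are neighbouring if they differ in at most one entry. -/
def Neighbouring {X : Type*} {n : ℕ} (x x' : Fin n → X) : Prop :=
  ∃ i, ∀ j, j ≠ i → x j = x' j

/-- The mechanism `M`, which maps an `n`-tuple of inputs to the law of a random output, is
(centrally) `(ε, δ)`-differentially private. `Neighbouring` is symmetric, so both directions
of the inequality are required. -/
def IsDP {X Z : Type*} [MeasurableSpace Z] {n : ℕ}
    (M : (Fin n → X) → Measure Z) (ε δ : ℝ) : Prop :=
  ∀ x x' : Fin n → X, Neighbouring x x' → DPBound ε δ (M x) (M x')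

/-- The joint law of the `n` noisy convolution outputs of a round: the exact outputs
`x 0, …, x (n - 1)` are obfuscated one by one, independently, by the local randomizer `R`. -/
def convolutionOutputs {X Y : Type*} [MeasurableSpace Y] (R : X → Measure Y) {n : ℕ}
    (x : Fin n → X) : Measure (Fin n → Y) :=
  Measure.pi fun i => R (x i)

/-- The shuffler: the law of `(y (σ 0), …, y (σ (n - 1)))`, where `y` has law `μ` and `σ` is an
independent uniformly random permutation. -/
def shuffle {Y : Type*} [MeasurableSpace Y] {n : ℕ} (μ : Measure (Fin n → Y)) :
    Measure (Fin n → Y) :=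
  ∑ σ : Equiv.Perm (Fin n),
    ((n.factorial : ENNReal))⁻¹ • μ.map (fun y i => y (σ i))

/-- What the client observes in a round: the noisy convolution outputs, shuffled by the server
with a fresh uniformly random permutation. -/
def clientView {X Y : Type*} [MeasurableSpace Y] (R : X → Measure Y) {n : ℕ}
    (x : Fin n → X) : Measure (Fin n → Y) :=
  shuffle (convolutionOutputs R x)

end Safhire

end

namespace Safhire

open Finset
open scoped NNReal

/-! Privacy amplification by clones. Fix an event and regard its probability after shuffling as a
function Φ of the n output laws. Over finite measures Φ is multilinear and invariant under
permutations (`shuffledMass`), so laws can be split algebraically into sub-probability pieces.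

Write e = exp ε₀, c = 1/e, a = e/(e+1), b = 1/(e+1). Up to mass δ₀, the two laws at the changed
index are a q₀ + b q₁ and b q₀ + a q₁ (`exists_randomizedResponse`). Every other law is close to
(c/2)(q₀ + q₁) + L i with L i of mass at most 1 - c (`exists_clone_remainder`): with probability c
that entry is a clone, a fair coin flip between q₀ and q₁.

Expand Φ over the set V of clones. By symmetry each term depends only on the number of factors q₀,
so having q₀ instead of q₁ at the changed index shifts a Bin(|V|, 1/2) variable by one. With N = cn,
Chernoff gives |V| ≥ N/2 up to probability exp(-l); the shift then costs a factor 1 + r and another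
exp(-l) (`sum_choose_shift_le`). For l = ln(2/δ) the two errors add up to δ. Mixing with weights a,
b improves r to (a - b) r (`mixture_le`). Passing from the true laws to their approximations and
back, one factor at a time (`shuffledMass_le_add`), produces the δ₀ term. -/

/-! ### Binomial tails and the shifted binomial -/

theorem sum_choose_mul_exp (k : ℕ) (t : ℝ) :
    ∑ j ∈ range (k + 1), (k.choose j : ℝ) * Real.exp (t * (2 * j - k)) = (2 * Real.cosh t) ^ k := by
  have h : 2 * Real.cosh t = Real.exp t + Real.exp (-t) := by rw [Real.cosh_eq]; ring
  rw [h, add_pow]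
  refine sum_congr rfl fun j hj => ?_
  have hjk : j ≤ k := Nat.lt_succ_iff.1 (mem_range.1 hj)
  rw [← Real.exp_nat_mul, ← Real.exp_nat_mul, ← Real.exp_add, mul_comm, Nat.cast_sub hjk]
  congr 2
  ring

/-- Hoeffding's upper tail bound for a symmetric binomial variable. -/
theorem sum_choose_tail_le (k : ℕ) (hk : 0 < k) (τ : ℝ) (hτ : 0 ≤ τ) :
    ∑ j ∈ (range (k + 1)).filter (fun j : ℕ => τ < 2 * (j : ℝ) - k), (k.choose j : ℝ) ≤
      2 ^ k * Real.exp (-(τ ^ 2 / (2 * k))) := by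
  have hk' : (0 : ℝ) < k := by exact_mod_cast hk
  -- The tilt minimising k t²/2 - t τ.
  set t : ℝ := τ / k with ht
  have ht0 : 0 ≤ t := by positivity
  calc ∑ j ∈ (range (k + 1)).filter (fun j : ℕ => τ < 2 * (j : ℝ) - k), (k.choose j : ℝ)
      ≤ ∑ j ∈ (range (k + 1)).filter (fun j : ℕ => τ < 2 * (j : ℝ) - k),
          (k.choose j : ℝ) * Real.exp (t * (2 * j - k)) * Real.exp (-(t * τ)) := by
        refine sum_le_sum fun j hj => ?_
        have hj' := (mem_filter.1 hj).2
        rw [mul_assoc, ← Real.exp_add]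
        refine le_mul_of_one_le_right (by positivity) (Real.one_le_exp ?_)
        nlinarith
    _ ≤ ∑ j ∈ range (k + 1),
          (k.choose j : ℝ) * Real.exp (t * (2 * j - k)) * Real.exp (-(t * τ)) :=
        sum_le_sum_of_subset_of_nonneg (filter_subset _ _) fun _ _ _ => by positivity
    _ = (2 * Real.cosh t) ^ k * Real.exp (-(t * τ)) := by
        rw [← sum_mul, sum_choose_mul_exp]
    _ ≤ (2 * Real.exp (t ^ 2 / 2)) ^ k * Real.exp (-(t * τ)) := by
        have := Real.cosh_le_exp_half_sq t
        have := Real.cosh_pos t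
        gcongr
    _ = 2 ^ k * Real.exp (-(τ ^ 2 / (2 * k))) := by
        rw [mul_pow, ← Real.exp_nat_mul, mul_assoc, ← Real.exp_add]
        congr 2
        rw [ht]
        field_simp
        ring

/-- Shifting a symmetric binomial variable by one changes the expectation of a bounded
nonnegative function by a factor of at most `1 + r`, up to a small additive error. -/
theorem sum_choose_shift_le (k : ℕ) (N l r B : ℝ) (g : ℕ → ℝ) (hg : ∀ j, 0 ≤ g j)
    (hgB : ∀ j, g j ≤ B) (hl : 0 < l) (hN : 16 * l ≤ N) (hk : N / 2 ≤ k)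
    (hr : 8 * Real.sqrt (l / N) + 8 / N ≤ r) :
    ∑ j ∈ range (k + 1), (k.choose j : ℝ) * g (j + 1) ≤
      (1 + r) * ∑ j ∈ range (k + 1), (k.choose j : ℝ) * g j + 2 ^ k * Real.exp (-l) * B := by
  have hN0 : 0 < N := by linarith
  have hk0 : (0 : ℝ) < k := by linarith
  have hB : 0 ≤ B := (hg 0).trans (hgB 0)
  have hr0 : 0 ≤ r := le_trans (by positivity) hr
  -- Chosen so that the Hoeffding tail beyond τ is exactly exp(-l).
  set τ : ℝ := Real.sqrt (2 * k * l) with hτ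
  have hτ0 : 0 ≤ τ := Real.sqrt_nonneg _
  have hτsq : τ ^ 2 = 2 * k * l := Real.sq_sqrt (by positivity)
  have hτk : τ ≤ k / 2 := by
    rw [hτ, Real.sqrt_le_left (by positivity)]
    nlinarith
  have hτr : 1 + τ ≤ r * (k / 4) := by
    have h1 : τ ≤ 2 * k * Real.sqrt (l / N) := by
      rw [hτ]
      refine Real.sqrt_le_iff.2 ⟨by positivity, ?_⟩
      rw [mul_pow, Real.sq_sqrt (by positivity), ← sub_nonneg]
      have : (2 * k) ^ 2 * (l / N) - 2 * k * l = 2 * k * l * (2 * k - N) / N := by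
        field_simp
      rw [this]
      have : 0 ≤ 2 * (k : ℝ) - N := by linarith
      positivity
    have h2 : 1 ≤ 2 * k / N := by rw [le_div_iff₀ hN0]; linarith
    calc 1 + τ ≤ 2 * k / N + 2 * k * Real.sqrt (l / N) := by linarith
      _ = (8 * Real.sqrt (l / N) + 8 / N) * (k / 4) := by ring
      _ ≤ r * (k / 4) := by gcongr
  -- The ratio of consecutive binomial coefficients is (j+1)/(k-j). Below the threshold k - j ≥ k/4,
  -- because τ ≤ k/2, and the numerator exceeds the denominator by at most 1 + τ ≤ r k/4.
  have hgood : ∀ j ∈ range (k + 1), ¬ τ < 2 * (j : ℝ) - k →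
      (k.choose j : ℝ) * g (j + 1) ≤ (1 + r) * ((k.choose (j + 1) : ℝ) * g (j + 1)) := by
    intro j hj hjτ
    have hjk : j ≤ k := Nat.lt_succ_iff.1 (mem_range.1 hj)
    have h1 : (k.choose (j + 1) : ℝ) * (j + 1) = k.choose j * (k - j) := by
      rw [← Nat.cast_sub hjk]; exact_mod_cast Nat.choose_succ_right_eq k j
    have h2 : (j : ℝ) + 1 ≤ (1 + r) * (k - j) := by
      have : r * (k / 4) ≤ r * (k - j) := by
        refine mul_le_mul_of_nonneg_left ?_ hr0
        linarith
      linarith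
    have h3 : (k.choose j : ℝ) ≤ (1 + r) * k.choose (j + 1) := by
      refine le_of_mul_le_mul_right ?_ (by positivity : (0 : ℝ) < j + 1)
      calc (k.choose j : ℝ) * (j + 1) ≤ k.choose j * ((1 + r) * (k - j)) := by gcongr
        _ = (1 + r) * k.choose (j + 1) * (j + 1) := by rw [mul_assoc, h1]; ring
    rw [← mul_assoc]
    exact mul_le_mul_of_nonneg_right h3 (hg _)
  have hshift : ∑ j ∈ range (k + 1), (k.choose (j + 1) : ℝ) * g (j + 1) ≤
      ∑ j ∈ range (k + 1), (k.choose j : ℝ) * g j := by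
    have h := sum_range_succ' (fun j => (k.choose j : ℝ) * g j) (k + 1)
    rw [sum_range_succ, Nat.choose_eq_zero_of_lt (Nat.lt_succ_self k)] at h
    have := hg 0
    simp at h
    linarith
  rw [← sum_filter_add_sum_filter_not (range (k + 1)) (fun j : ℕ => τ < 2 * (j : ℝ) - k), add_comm]
  refine add_le_add ?_ ?_
  · calc ∑ j ∈ (range (k + 1)).filter (fun j : ℕ => ¬ τ < 2 * (j : ℝ) - k), (k.choose j : ℝ) * g (j + 1)
        ≤ ∑ j ∈ (range (k + 1)).filter (fun j : ℕ => ¬ τ < 2 * (j : ℝ) - k),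
            (1 + r) * ((k.choose (j + 1) : ℝ) * g (j + 1)) :=
          sum_le_sum fun j hj => hgood j (mem_filter.1 hj).1 (mem_filter.1 hj).2
      _ ≤ ∑ j ∈ range (k + 1), (1 + r) * ((k.choose (j + 1) : ℝ) * g (j + 1)) :=
          sum_le_sum_of_subset_of_nonneg (filter_subset _ _) fun j _ _ => by
            have := hg (j + 1); positivity
      _ ≤ _ := by
          rw [← mul_sum]
          exact mul_le_mul_of_nonneg_left hshift (by linarith)
  · calc ∑ j ∈ (range (k + 1)).filter (fun j : ℕ => τ < 2 * (j : ℝ) - k), (k.choose j : ℝ) * g (j + 1)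
        ≤ ∑ j ∈ (range (k + 1)).filter (fun j : ℕ => τ < 2 * (j : ℝ) - k), (k.choose j : ℝ) * B :=
          sum_le_sum fun j _ => by gcongr; exact hgB _
      _ ≤ 2 ^ k * Real.exp (-(τ ^ 2 / (2 * k))) * B := by
          rw [← sum_mul]
          exact mul_le_mul_of_nonneg_right
            (sum_choose_tail_le k (by exact_mod_cast hk0) τ hτ0) hB
      _ = _ := by
          rw [hτsq, mul_div_cancel_left₀ l (by positivity)]

/-- Chernoff's lower tail bound for the size of a random subset that contains every element of
`A` independently with probability `c`. -/
theorem sum_powerset_lower_tail_le {ι : Type*} [DecidableEq ι] (A : Finset ι) (c N l : ℝ)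
    (hc0 : 0 ≤ c) (hc1 : c ≤ 1) (hN : N = c * (#A + 1)) (hl : Real.log 2 ≤ l)
    (hlN : 16 * l ≤ N) :
    ∑ V ∈ A.powerset with (#V : ℝ) < N / 2, c ^ #V * (1 - c) ^ (#A - #V) ≤ Real.exp (-l) := by
  have hlog := Real.log_two_lt_d9
  have hlog' := Real.log_two_gt_d9
  have h1c : 0 ≤ 1 - c := by linarith
  -- Exponential Markov inequality with base 2: the factor 2^(N/2 - #V) is at least 1 on the event.
  -- The base is not optimal but suffices.
  calc ∑ V ∈ A.powerset with (#V : ℝ) < N / 2, c ^ #V * (1 - c) ^ (#A - #V)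
      ≤ ∑ V ∈ A.powerset with (#V : ℝ) < N / 2,
          Real.exp (Real.log 2 * (N / 2)) * ((c / 2) ^ #V * (1 - c) ^ (#A - #V)) := by
        refine sum_le_sum fun V hV => ?_
        have hV' := (mem_filter.1 hV).2
        have h2 : (2 : ℝ) ^ #V ≤ Real.exp (Real.log 2 * (N / 2)) := by
          rw [← Real.exp_log (by positivity : (0 : ℝ) < 2 ^ #V), Real.log_pow]
          refine Real.exp_le_exp.2 ?_
          nlinarith
        rw [div_pow, ← mul_assoc, mul_div_assoc']
        refine mul_le_mul_of_nonneg_right ?_ (by positivity)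
        rw [le_div_iff₀ (by positivity), mul_comm]
        gcongr
    _ ≤ ∑ V ∈ A.powerset,
          Real.exp (Real.log 2 * (N / 2)) * ((c / 2) ^ #V * (1 - c) ^ (#A - #V)) :=
        sum_le_sum_of_subset_of_nonneg (filter_subset _ _) fun _ _ _ => by positivity
    _ = Real.exp (Real.log 2 * (N / 2)) * (1 - c / 2) ^ #A := by
        rw [← mul_sum, sum_pow_mul_eq_add_pow]
        congr 2
        ring
    _ ≤ Real.exp (Real.log 2 * (N / 2)) * (Real.exp (-(c / 2))) ^ #A := by
        have := Real.add_one_le_exp (-(c / 2))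
        gcongr
        · linarith
        · linarith
    _ ≤ Real.exp (-l) := by
        rw [← Real.exp_nat_mul, ← Real.exp_add]
        -- Since `A` omits one index, c #A = N - c; the lost c/2 in the exponent is absorbed using
        -- log 2 ≤ l.
        refine Real.exp_le_exp.2 ?_
        nlinarith

/-- The two mixtures differ by (a - b)(A - B). If A ≤ B this is nonpositive; otherwise B lies below
the mixture b A + a B, so A - B ≤ r (b A + a B) + τ. -/
theorem mixture_le {A B a b r τ : ℝ} (hr : 0 ≤ r) (hτ : 0 ≤ τ) (hb : 0 ≤ b) (hab : b ≤ a)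
    (h1 : a + b = 1) (hA : 0 ≤ A) (hB : 0 ≤ B) (h : A ≤ (1 + r) * B + τ) :
    a * A + b * B ≤ (1 + (a - b) * r) * (b * A + a * B) + τ := by
  obtain rfl : a = 1 - b := by linarith
  rcases le_total A B with hAB | hAB
  · have h2 : 0 ≤ (1 - b - b) * (B - A) := mul_nonneg (by linarith) (by linarith)
    have h3 : 0 ≤ (1 - b - b) * r * (b * A + (1 - b) * B) :=
      mul_nonneg (mul_nonneg (by linarith) hr) (by nlinarith)
    nlinarith
  · have h2 : A - B ≤ r * (b * A + (1 - b) * B) + τ := by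
      have : 0 ≤ r * (b * (A - B)) := mul_nonneg hr (mul_nonneg hb (by linarith))
      nlinarith
    have h3 := mul_le_mul_of_nonneg_left h2 (by linarith : 0 ≤ 1 - b - b)
    have h4 : 0 ≤ 2 * b * τ := by positivity
    nlinarith

/-! ### Clone expansion of symmetric multilinear functionals -/

section Multilinear

variable {ι M : Type*} [DecidableEq ι]

/-- The family that is `q₀` on `u`, `q₁` on `E \ u`, and `L` outside `E`. -/
def threeWay (E u : Finset ι) (q₀ q₁ : M) (L : ι → M) : ι → M :=
  fun i => if i ∈ E then (if i ∈ u then q₀ else q₁) else L i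

/-- Both families factor through labellings whose fibres have equal sizes, so fibrewise bijections
glue to a permutation. Indices outside `E` carry their own label because `L` varies with the index.
-/
theorem exists_perm_threeWay_comp [Fintype ι] (E u u' : Finset ι) (hu : u ⊆ E) (hu' : u' ⊆ E)
    (h : #u = #u') (q₀ q₁ : M) (L : ι → M) :
    ∃ σ : Equiv.Perm ι, threeWay E u q₀ q₁ L = threeWay E u' q₀ q₁ L ∘ σ := by
  let lab : Finset ι → ι → Bool ⊕ ι := fun w i =>
    if i ∈ E then Sum.inl (decide (i ∈ w)) else Sum.inr i
  have hlab : ∀ w, threeWay E w q₀ q₁ L =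
      Sum.elim (fun t : Bool => if t then q₀ else q₁) L ∘ lab w := by
    intro w
    funext i
    simp only [threeWay, lab, Function.comp]
    split_ifs <;> simp_all
  have hcard : ∀ w ⊆ E, ∀ y, Fintype.card {i // lab w i = y} =
      match y with
      | Sum.inl true => #w
      | Sum.inl false => #E - #w
      | Sum.inr i => if i ∈ E then 0 else 1 := by
    intro w hw y
    rw [Fintype.card_subtype]
    rcases y with (_ | _) | i
    · rw [← card_sdiff_of_subset hw]
      congr 1
      ext i
      by_cases hi : i ∈ E <;> simp [lab, hi]
    · congr 1
      ext i
      by_cases hi : i ∈ E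
      · simp [lab, hi]
      · simpa [lab, hi] using fun h => hi (hw h)
    · by_cases hi : i ∈ E
      · simp only [hi, if_true, card_eq_zero, filter_eq_empty_iff]
        intro j _
        by_cases hj : j ∈ E
        · simp [lab, hj]
        · simp only [lab, hj, if_false, Sum.inr.injEq]
          rintro rfl
          exact hj hi
      · simp only [hi, if_false]
        rw [card_eq_one]
        refine ⟨i, ?_⟩
        ext j
        by_cases hj : j ∈ E
        · simp only [lab, hj, if_true, mem_filter, mem_singleton, reduceCtorEq, and_false, false_iff]
          rintro rfl
          exact hi hj
        · simp [lab, hj]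
  have hequiv : ∀ y, Nonempty ({i // lab u i = y} ≃ {i // lab u' i = y}) := by
    intro y
    rw [← Fintype.card_eq, hcard u hu, hcard u' hu', h]
  refine ⟨Equiv.ofFiberEquiv fun y => (hequiv y).some, ?_⟩
  funext i
  rw [hlab, hlab]
  simp only [Function.comp, Equiv.ofFiberEquiv_map]

variable [AddCommMonoid M] [Module ℝ≥0 M] (Φ : MultilinearMap ℝ≥0 (fun _ : ι => M) ℝ≥0)
  (mass : M → ℝ≥0)

/-- Expanding every clone `q₀ + q₁` in a symmetric multilinear functional: the values only depend
on the number of factors `q₀`. -/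
theorem exists_clone_expansion [Fintype ι]
    (hsymm : ∀ (ν : ι → M) (σ : Equiv.Perm ι), Φ (ν ∘ σ) = Φ ν)
    (hmass : ∀ ν : ι → M, Φ ν ≤ ∏ i, mass (ν i)) (i₀ : ι) (V : Finset ι) (hV : i₀ ∉ V)
    (q₀ q₁ : M) (hq₀ : mass q₀ ≤ 1) (hq₁ : mass q₁ ≤ 1) (L : ι → M) :
    ∃ g : ℕ → ℝ, (∀ j, 0 ≤ g j) ∧
      (∀ j, g j ≤ ∏ i ∈ univ.erase i₀ \ V, (mass (L i) : ℝ)) ∧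
      (Φ (V.piecewise (fun _ => q₀ + q₁) (Function.update L i₀ q₀)) : ℝ) =
        ∑ j ∈ range (#V + 1), ((#V).choose j : ℝ) * g (j + 1) ∧
      (Φ (V.piecewise (fun _ => q₀ + q₁) (Function.update L i₀ q₁)) : ℝ) =
        ∑ j ∈ range (#V + 1), ((#V).choose j : ℝ) * g j := by
  classical
  set E := insert i₀ V with hE
  have hVE : V ⊆ E := subset_insert _ _
  have key : ∀ u ⊆ E, ∀ u' ⊆ E, #u = #u' →
      Φ (threeWay E u q₀ q₁ L) = Φ (threeWay E u' q₀ q₁ L) := by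
    intro u hu u' hu' h
    obtain ⟨σ, hσ⟩ := exists_perm_threeWay_comp E u u' hu hu' h q₀ q₁ L
    rw [hσ, hsymm]
  have hex : ∀ j, ∃ x : ℝ, 0 ≤ x ∧ x ≤ ∏ i ∈ univ.erase i₀ \ V, (mass (L i) : ℝ) ∧
      ∀ u ⊆ E, #u = j → (Φ (threeWay E u q₀ q₁ L) : ℝ) = x := by
    intro j
    by_cases h : ∃ u ⊆ E, #u = j
    · obtain ⟨u, hu, rfl⟩ := h
      refine ⟨Φ (threeWay E u q₀ q₁ L), NNReal.coe_nonneg _, ?_, fun u' hu' h => ?_⟩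
      · rw [← NNReal.coe_prod, NNReal.coe_le_coe]
        refine (hmass _).trans ?_
        have hsd : univ.erase i₀ \ V = Eᶜ := by
          ext i; simp [hE]
        rw [hsd, ← prod_mul_prod_compl E]
        refine mul_le_of_le_one_of_le ?_ (le_of_eq ?_)
        · refine prod_le_one' fun i hi => ?_
          simp only [threeWay, hi, if_true]
          split_ifs <;> assumption
        · refine prod_congr rfl fun i hi => ?_
          simp [threeWay, mem_compl.1 hi]
      · rw [key u' hu' u hu h]
    -- Default value for j > #V + 1, where no such subset exists.
    · exact ⟨0, le_rfl, prod_nonneg fun _ _ => NNReal.coe_nonneg _,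
        fun u hu hj => (h ⟨u, hu, hj⟩).elim⟩
  choose g hg0 hgB hg using hex
  have hexp : ∀ x : M, Φ (V.piecewise (fun _ => q₀ + q₁) (Function.update L i₀ x)) =
      ∑ u ∈ V.powerset, Φ (u.piecewise (fun _ => q₀)
        (V.piecewise (fun _ => q₁) (Function.update L i₀ x))) := by
    intro x
    rw [← Φ.map_piecewise_add]
    congr 1
    funext i
    by_cases hi : i ∈ V <;> simp [hi]
  have hsum : ∀ s : ℕ, ∑ u ∈ V.powerset, g (#u + s) =
      ∑ j ∈ range (#V + 1), ((#V).choose j : ℝ) * g (j + s) := by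
    intro s
    rw [sum_powerset_apply_card (fun j => g (j + s))]
    simp
  refine ⟨g, hg0, hgB, ?_, ?_⟩
  · rw [hexp, ← hsum 1, NNReal.coe_sum]
    refine sum_congr rfl fun u hu => ?_
    have huV := mem_powerset.1 hu
    have hi₀u : i₀ ∉ u := fun h => hV (huV h)
    rw [← hg (#u + 1) (insert i₀ u) (insert_subset_insert _ huV) (card_insert_of_notMem hi₀u)]
    congr 2
    funext i
    by_cases hi : i = i₀
    · subst hi
      simp [threeWay, hE, hi₀u, hV]
    · by_cases hiu : i ∈ u
      · simp [threeWay, hE, hi, hiu, huV hiu]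
      · by_cases hiV : i ∈ V <;> simp [threeWay, hE, hi, hiu, hiV]
  · have h := hsum 0
    simp only [add_zero] at h
    rw [hexp, ← h, NNReal.coe_sum]
    refine sum_congr rfl fun u hu => ?_
    have huV := mem_powerset.1 hu
    have hi₀u : i₀ ∉ u := fun h => hV (huV h)
    rw [← hg #u u (huV.trans hVE) rfl]
    congr 2
    funext i
    by_cases hi : i = i₀
    · subst hi
      simp [threeWay, hE, hi₀u, hV]
    · by_cases hiu : i ∈ u
      · simp [threeWay, hE, hi, hiu, huV hiu]
      · by_cases hiV : i ∈ V <;> simp [threeWay, hE, hi, hiu, hiV]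

/-- `V` is the set of indices, other than `i₀`, at which the clone component is selected. -/
theorem map_update_clones [Fintype ι] (c : ℝ≥0) (w : M) (L : ι → M) (i₀ : ι) (x : M) :
    Φ (Function.update (fun i => c • w + L i) i₀ x) =
      ∑ V ∈ (univ.erase i₀).powerset,
        c ^ #V * Φ (V.piecewise (fun _ => w) (Function.update L i₀ x)) := by
  have h := Φ.map_piecewise_add (fun _ => c • w) (Function.update L i₀ x) (univ.erase i₀)
  have h' : (univ.erase i₀).piecewise ((fun _ => c • w) + Function.update L i₀ x)
      (Function.update L i₀ x) = Function.update (fun i => c • w + L i) i₀ x := by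
    funext i
    by_cases hi : i = i₀
    · subst hi; simp
    · simp [hi]
  rw [← h', h]
  refine sum_congr rfl fun V _ => ?_
  have h2 := Φ.map_piecewise_smul (fun _ => c)
    (V.piecewise (fun _ => w) (Function.update L i₀ x)) V
  rw [prod_const, smul_eq_mul] at h2
  rw [← h2]
  congr 1
  funext i
  by_cases hi : i ∈ V <;> simp [hi]

theorem map_update_mix (ν : ι → M) (i₀ : ι) (a b : ℝ≥0) (x y : M) :
    Φ (Function.update ν i₀ (a • x + b • y)) =
      a * Φ (Function.update ν i₀ x) + b * Φ (Function.update ν i₀ y) := by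
  rw [Φ.map_update_add, Φ.map_update_smul, Φ.map_update_smul, smul_eq_mul, smul_eq_mul]

/-- Privacy amplification by clones for a symmetric multilinear functional. -/
theorem clone_amplification [Fintype ι]
    (hsymm : ∀ (ν : ι → M) (σ : Equiv.Perm ι), Φ (ν ∘ σ) = Φ ν)
    (hmass : ∀ ν : ι → M, Φ ν ≤ ∏ i, mass (ν i)) (i₀ : ι)
    (q₀ q₁ : M) (hq₀ : mass q₀ ≤ 1) (hq₁ : mass q₁ ≤ 1) (L : ι → M) (c : ℝ≥0) (hc : c ≤ 1)
    (hL : ∀ i, mass (L i) ≤ 1 - c) (a b : ℝ≥0) (hab : b ≤ a) (hab1 : a + b = 1)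
    (l r N : ℝ) (hN : N = c * Fintype.card ι) (hl : Real.log 2 ≤ l) (hlN : 16 * l ≤ N)
    (hr : 8 * Real.sqrt (l / N) + 8 / N ≤ r) :
    (Φ (Function.update (fun i => (c / 2) • (q₀ + q₁) + L i) i₀ (a • q₀ + b • q₁)) : ℝ) ≤
      (1 + (a - b) * r) *
        Φ (Function.update (fun i => (c / 2) • (q₀ + q₁) + L i) i₀ (b • q₀ + a • q₁)) +
        2 * Real.exp (-l) := by
  have hl0 : 0 < l := (Real.log_pos one_lt_two).trans_le hl
  have hN0 : 0 < N := by linarith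
  have hr0 : 0 ≤ r := le_trans (by positivity) hr
  have habR : (a : ℝ) + b = 1 := by exact_mod_cast hab1
  have hbaR : (b : ℝ) ≤ a := by exact_mod_cast hab
  have hcR : (c : ℝ) ≤ 1 := by exact_mod_cast hc
  have hLR : ∀ i, (mass (L i) : ℝ) ≤ 1 - c := by
    intro i
    have := NNReal.coe_le_coe.2 (hL i)
    rwa [NNReal.coe_sub hc, NNReal.coe_one] at this
  set A : Finset ι := univ.erase i₀ with hA
  have hcardA : #A + 1 = Fintype.card ι := by
    rw [hA, card_erase_add_one (mem_univ _), card_univ]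
  -- The law of a random subset containing each index with probability c.
  let w : Finset ι → ℝ := fun V => (c : ℝ) ^ #V * (1 - c) ^ (#A - #V)
  have hwsum : ∑ V ∈ A.powerset, w V = 1 := by
    simp only [w]
    rw [sum_pow_mul_eq_add_pow]
    simp
  have hterm : ∀ V ∈ A.powerset,
      ((c / 2 : ℝ≥0) : ℝ) ^ #V *
        (a * Φ (V.piecewise (fun _ => q₀ + q₁) (Function.update L i₀ q₀)) +
          b * Φ (V.piecewise (fun _ => q₀ + q₁) (Function.update L i₀ q₁))) ≤
      (1 + (a - b) * r) * (((c / 2 : ℝ≥0) : ℝ) ^ #V *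
        (b * Φ (V.piecewise (fun _ => q₀ + q₁) (Function.update L i₀ q₀)) +
          a * Φ (V.piecewise (fun _ => q₀ + q₁) (Function.update L i₀ q₁)))) +
      ((if (#V : ℝ) < N / 2 then w V else 0) + Real.exp (-l) * w V) := by
    intro V hV
    have hVA := mem_powerset.1 hV
    have hi₀V : i₀ ∉ V := fun h => by simpa [hA] using hVA h
    obtain ⟨g, hg0, hgB, h₀, h₁⟩ :=
      exists_clone_expansion Φ mass hsymm hmass i₀ V hi₀V q₀ q₁ hq₀ hq₁ L
    have hB : ∏ i ∈ A \ V, (mass (L i) : ℝ) ≤ (1 - c) ^ (#A - #V) := by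
      rw [← card_sdiff_of_subset hVA, ← prod_const]
      exact prod_le_prod (fun _ _ => NNReal.coe_nonneg _) fun i _ => hLR i
    replace hgB : ∀ j, g j ≤ (1 - c) ^ (#A - #V) := fun j => (hgB j).trans hB
    have hB0 : (0 : ℝ) ≤ (1 - c) ^ (#A - #V) := (hg0 0).trans (hgB 0)
    rw [h₀, h₁]
    set S₀ := ∑ j ∈ range (#V + 1), ((#V).choose j : ℝ) * g (j + 1)
    set S₁ := ∑ j ∈ range (#V + 1), ((#V).choose j : ℝ) * g j
    have hS₀ : 0 ≤ S₀ := sum_nonneg fun j _ => mul_nonneg (Nat.cast_nonneg _) (hg0 _)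
    have hS₁ : 0 ≤ S₁ := sum_nonneg fun j _ => mul_nonneg (Nat.cast_nonneg _) (hg0 _)
    -- With too few clones, S₀ is bounded by its total mass; otherwise the shift estimate applies.
    have hτ : S₀ ≤ (1 + r) * S₁ + 2 ^ #V *
        ((if (#V : ℝ) < N / 2 then 1 else 0) + Real.exp (-l)) * (1 - c) ^ (#A - #V) := by
      split_ifs with hlt
      · have h1 : S₀ ≤ 2 ^ #V * (1 - c) ^ (#A - #V) := by
          calc S₀ ≤ ∑ j ∈ range (#V + 1), ((#V).choose j : ℝ) * (1 - c) ^ (#A - #V) :=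
                sum_le_sum fun j _ => mul_le_mul_of_nonneg_left (hgB _) (Nat.cast_nonneg _)
            _ = _ := by
              rw [← sum_mul, ← Nat.cast_sum, Nat.sum_range_choose]
              push_cast
              rfl
        have h2 : 0 ≤ (1 + r) * S₁ := by positivity
        have h3 : 0 ≤ 2 ^ #V * Real.exp (-l) * (1 - c : ℝ) ^ (#A - #V) := by positivity
        nlinarith
      · rw [zero_add]
        exact sum_choose_shift_le #V N l r _ g hg0 hgB hl0 hlN (not_lt.1 hlt) hr
    have hmix := mixture_le hr0
      (mul_nonneg (mul_nonneg (by positivity) (add_nonneg (by split_ifs <;> norm_num)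
        (Real.exp_pos _).le)) hB0) b.coe_nonneg hbaR habR hS₀ hS₁ hτ
    have hfin := mul_le_mul_of_nonneg_left hmix
      (pow_nonneg (NNReal.coe_nonneg (c / 2)) #V)
    refine hfin.trans (le_of_eq ?_)
    have hc2 : ((c / 2 : ℝ≥0) : ℝ) ^ #V * 2 ^ #V = (c : ℝ) ^ #V := by
      rw [← mul_pow]; congr 1; push_cast; ring
    rw [mul_add]
    congr 1
    · ring
    · simp only [w]
      rw [← hc2]
      split_ifs <;> ring
  have hexp : ∀ a b : ℝ≥0,
      (Φ (Function.update (fun i => (c / 2) • (q₀ + q₁) + L i) i₀ (a • q₀ + b • q₁)) : ℝ) =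
      ∑ V ∈ A.powerset, ((c / 2 : ℝ≥0) : ℝ) ^ #V *
        (a * Φ (V.piecewise (fun _ => q₀ + q₁) (Function.update L i₀ q₀)) +
          b * Φ (V.piecewise (fun _ => q₀ + q₁) (Function.update L i₀ q₁))) := by
    intro a b
    rw [map_update_mix, map_update_clones, map_update_clones]
    push_cast
    rw [mul_sum, mul_sum, ← sum_add_distrib]
    refine sum_congr rfl fun V _ => ?_
    ring
  rw [hexp, hexp, mul_sum]
  refine (sum_le_sum hterm).trans ?_
  rw [sum_add_distrib]
  refine add_le_add_right ?_ _
  rw [sum_add_distrib, ← mul_sum, hwsum, ← sum_filter, two_mul, mul_one]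
  refine add_le_add_left ?_ _
  refine sum_powerset_lower_tail_le A c N l c.coe_nonneg hcR ?_ hl hlN
  rw [hN, ← hcardA]
  push_cast
  ring

end Multilinear

/-! ### Product measures as multilinear symmetric objects -/

section ProductMeasure

variable {ι Y : Type*} [Fintype ι] [MeasurableSpace Y]

theorem prod_update_apply [DecidableEq ι] (ν : ι → FiniteMeasure Y) (i : ι) (z : FiniteMeasure Y)
    (s : ι → Set Y) :
    ∏ j, (Function.update ν i z j : Measure Y) (s j) =
      (z : Measure Y) (s i) * ∏ j ∈ univ.erase i, (ν j : Measure Y) (s j) := by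
  rw [← mul_prod_erase univ _ (mem_univ i), Function.update_self]
  congr 1
  refine prod_congr rfl fun j hj => ?_
  rw [Function.update_of_ne (ne_of_mem_erase hj)]

theorem pi_update_add [DecidableEq ι] (ν : ι → FiniteMeasure Y) (i : ι) (x y : FiniteMeasure Y) :
    Measure.pi (fun j => (Function.update ν i (x + y) j : Measure Y)) =
      Measure.pi (fun j => (Function.update ν i x j : Measure Y)) +
        Measure.pi (fun j => (Function.update ν i y j : Measure Y)) := by
  refine Measure.pi_eq fun s _ => ?_
  rw [Measure.add_apply, Measure.pi_pi, Measure.pi_pi]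
  rw [prod_update_apply, prod_update_apply, prod_update_apply,
    FiniteMeasure.toMeasure_add, Measure.add_apply, add_mul]

theorem pi_update_smul [DecidableEq ι] (ν : ι → FiniteMeasure Y) (i : ι) (c : ℝ≥0)
    (x : FiniteMeasure Y) :
    Measure.pi (fun j => (Function.update ν i (c • x) j : Measure Y)) =
      c • Measure.pi (fun j => (Function.update ν i x j : Measure Y)) := by
  refine Measure.pi_eq fun s _ => ?_
  rw [Measure.smul_apply, Measure.pi_pi]
  rw [prod_update_apply, prod_update_apply, FiniteMeasure.toMeasure_smul, Measure.smul_apply,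
    smul_mul_assoc]

theorem pi_comp_perm (ν : ι → FiniteMeasure Y) (τ : Equiv.Perm ι) :
    Measure.pi (fun j => (ν (τ j) : Measure Y)) =
      (Measure.pi (fun j => (ν j : Measure Y))).map (fun y i => y (τ i)) := by
  refine Measure.pi_eq fun s hs => ?_
  have hmeas : Measurable (fun (y : ι → Y) i => y (τ i)) := by fun_prop
  rw [Measure.map_apply hmeas (MeasurableSet.univ_pi hs)]
  have : (fun (y : ι → Y) i => y (τ i)) ⁻¹' Set.univ.pi s =
      Set.univ.pi (fun j => s (τ.symm j)) := by
    ext y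
    simp only [Set.mem_preimage, Set.mem_univ_pi]
    constructor
    · intro h j
      simpa using h (τ.symm j)
    · intro h j
      simpa using h (τ j)
  rw [this, Measure.pi_pi]
  rw [← Equiv.prod_comp τ]
  simp

end ProductMeasure

/-! ### The shuffled probability of an event -/

section Shuffle

variable {Y : Type*} [MeasurableSpace Y] {n : ℕ}

theorem measurable_comp_perm (σ : Equiv.Perm (Fin n)) :
    Measurable (fun (y : Fin n → Y) i => y (σ i)) := by fun_prop

theorem shuffle_add (μ ν : Measure (Fin n → Y)) : shuffle (μ + ν) = shuffle μ + shuffle ν := by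
  simp only [shuffle, Measure.map_add _ _ (measurable_comp_perm _), smul_add, sum_add_distrib]

theorem shuffle_smul (c : ℝ≥0) (μ : Measure (Fin n → Y)) : shuffle (c • μ) = c • shuffle μ := by
  simp only [shuffle, Measure.map_smul, smul_sum]
  refine sum_congr rfl fun σ _ => ?_
  rw [smul_comm]

theorem shuffle_univ (μ : Measure (Fin n → Y)) : shuffle μ Set.univ = μ Set.univ := by
  simp only [shuffle, Measure.coe_finsetSum, Finset.sum_apply, Measure.smul_apply, smul_eq_mul,
    Measure.map_apply (measurable_comp_perm _) MeasurableSet.univ, Set.preimage_univ, sum_const,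
    card_univ, Fintype.card_perm, Fintype.card_fin, nsmul_eq_mul]
  rw [← mul_assoc, ENNReal.mul_inv_cancel, one_mul]
  · exact_mod_cast n.factorial_ne_zero
  · exact ENNReal.natCast_ne_top _

/-- Left multiplication by τ only reindexes the uniform sum over permutations. -/
theorem shuffle_map_perm (μ : Measure (Fin n → Y)) (τ : Equiv.Perm (Fin n)) :
    shuffle (μ.map (fun y i => y (τ i))) = shuffle μ := by
  simp only [shuffle, Measure.map_map (measurable_comp_perm _) (measurable_comp_perm _)]
  exact Equiv.sum_comp (Equiv.mulLeft τ)
    fun σ => ((n.factorial : ENNReal))⁻¹ • μ.map (fun y i => y (σ i))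

theorem shuffle_pi_apply_le (ν : Fin n → FiniteMeasure Y) (S : Set (Fin n → Y)) :
    shuffle (Measure.pi fun i => (ν i : Measure Y)) S ≤
      ((∏ i, (ν i).mass : ℝ≥0) : ENNReal) := by
  refine (measure_mono (Set.subset_univ S)).trans ?_
  rw [shuffle_univ, Measure.pi_univ]
  push_cast
  simp

theorem shuffle_pi_apply_ne_top (ν : Fin n → FiniteMeasure Y) (S : Set (Fin n → Y)) :
    shuffle (Measure.pi fun i => (ν i : Measure Y)) S ≠ ⊤ :=
  ne_top_of_le_ne_top ENNReal.coe_ne_top (shuffle_pi_apply_le ν S)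

/-- The probability of the event `S` after shuffling independent outputs, as a multilinear
functional of their laws. -/
noncomputable def shuffledMass (S : Set (Fin n → Y)) :
    MultilinearMap ℝ≥0 (fun _ : Fin n => FiniteMeasure Y) ℝ≥0 where
  toFun ν := (shuffle (Measure.pi fun i => (ν i : Measure Y)) S).toNNReal
  map_update_add' := by
    intro inst ν i x y
    -- The multilinearity fields quantify over an arbitrary decidability instance.
    obtain rfl : inst = instDecidableEqFin n := Subsingleton.elim _ _
    rw [pi_update_add, shuffle_add, Measure.add_apply,
      ENNReal.toNNReal_add (shuffle_pi_apply_ne_top _ S) (shuffle_pi_apply_ne_top _ S)]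
  map_update_smul' := by
    intro inst ν i c x
    obtain rfl : inst = instDecidableEqFin n := Subsingleton.elim _ _
    rw [pi_update_smul, shuffle_smul, Measure.smul_apply, ENNReal.smul_def, smul_eq_mul,
      ENNReal.toNNReal_mul, ENNReal.toNNReal_coe, smul_eq_mul]

theorem coe_shuffledMass (S : Set (Fin n → Y)) (ν : Fin n → FiniteMeasure Y) :
    (shuffledMass S ν : ENNReal) = shuffle (Measure.pi fun i => (ν i : Measure Y)) S :=
  ENNReal.coe_toNNReal (shuffle_pi_apply_ne_top ν S)

theorem shuffledMass_le (S : Set (Fin n → Y)) (ν : Fin n → FiniteMeasure Y) :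
    shuffledMass S ν ≤ ∏ i, (ν i).mass := by
  rw [← ENNReal.coe_le_coe, coe_shuffledMass]
  exact shuffle_pi_apply_le ν S

theorem shuffledMass_comp_perm (S : Set (Fin n → Y)) (ν : Fin n → FiniteMeasure Y)
    (σ : Equiv.Perm (Fin n)) : shuffledMass S (ν ∘ σ) = shuffledMass S ν := by
  rw [← ENNReal.coe_inj, coe_shuffledMass, coe_shuffledMass]
  simp only [Function.comp]
  rw [pi_comp_perm, shuffle_map_perm]

theorem exists_add_eq_of_le {μ ν : FiniteMeasure Y} (h : (μ : Measure Y) ≤ ν) :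
    ∃ ρ : FiniteMeasure Y, μ + ρ = ν := by
  have hfin : IsFiniteMeasure ((ν : Measure Y) - (μ : Measure Y)) :=
    isFiniteMeasure_of_le (ν : Measure Y) Measure.sub_le
  refine ⟨⟨(ν : Measure Y) - (μ : Measure Y), hfin⟩, FiniteMeasure.toMeasure_injective ?_⟩
  exact (add_comm _ _).trans (Measure.sub_add_cancel_of_le h)

theorem shuffledMass_update_mono (S : Set (Fin n → Y)) (ν : Fin n → FiniteMeasure Y) (i : Fin n)
    {x y : FiniteMeasure Y} (h : (x : Measure Y) ≤ y) :
    shuffledMass S (Function.update ν i x) ≤ shuffledMass S (Function.update ν i y) := by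
  obtain ⟨z, rfl⟩ := exists_add_eq_of_le h
  rw [MultilinearMap.map_update_add]
  exact le_self_add

/-- Perturbing the factors of a product of sub-probability measures. -/
theorem shuffledMass_le_add (S : Set (Fin n → Y)) (ν ν' D : Fin n → FiniteMeasure Y)
    (hν : ∀ i, (ν i).mass ≤ 1) (hν' : ∀ i, (ν' i).mass ≤ 1)
    (h : ∀ i, (ν i : Measure Y) ≤ (ν' i + D i : FiniteMeasure Y)) :
    shuffledMass S ν ≤ shuffledMass S ν' + ∑ i, (D i).mass := by
  -- Hybrid argument: replace one factor at a time, paying the mass of its defect.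
  suffices H : ∀ t : Finset (Fin n),
      shuffledMass S (t.piecewise ν ν') ≤ shuffledMass S ν' + ∑ i ∈ t, (D i).mass by
    simpa using H univ
  intro t
  induction t using Finset.induction_on with
  | empty => simp
  | insert i t hi ih =>
    set m := t.piecewise ν ν' with hm
    have hmi : Function.update m i (ν' i) = m := by
      rw [Function.update_eq_self_iff, hm, piecewise_eq_of_notMem _ _ _ hi]
    have hD : shuffledMass S (Function.update m i (D i)) ≤ (D i).mass := by
      refine (shuffledMass_le S _).trans ?_
      rw [← mul_prod_erase univ _ (mem_univ i), Function.update_self]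
      refine mul_le_of_le_one_right zero_le (prod_le_one' fun j hj => ?_)
      rw [Function.update_of_ne (ne_of_mem_erase hj), hm]
      by_cases hjt : j ∈ t
      · rw [piecewise_eq_of_mem _ _ _ hjt]; exact hν j
      · rw [piecewise_eq_of_notMem _ _ _ hjt]; exact hν' j
    rw [piecewise_insert, sum_insert hi]
    calc shuffledMass S (Function.update m i (ν i))
        ≤ shuffledMass S (Function.update m i (ν' i + D i)) :=
          shuffledMass_update_mono S m i (h i)
      _ = shuffledMass S m + shuffledMass S (Function.update m i (D i)) := by
          rw [MultilinearMap.map_update_add, hmi]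
      _ ≤ (shuffledMass S ν' + ∑ j ∈ t, (D j).mass) + (D i).mass := add_le_add ih hD
      _ = _ := by ring

end Shuffle

/-! ### Decomposing nearly indistinguishable measures -/

section Decomposition

variable {Y : Type*} [MeasurableSpace Y]

theorem toMeasure_le_iff {μ ν : FiniteMeasure Y} :
    (μ : Measure Y) ≤ ν ↔ ∀ S, MeasurableSet S → (μ S : ℝ) ≤ ν S := by
  rw [Measure.le_iff]
  refine forall₂_congr fun S _ => ?_
  rw [← FiniteMeasure.ennreal_coeFn_eq_coeFn_toMeasure,
    ← FiniteMeasure.ennreal_coeFn_eq_coeFn_toMeasure, ENNReal.coe_le_coe, NNReal.coe_le_coe]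

theorem coe_add_apply (μ ν : FiniteMeasure Y) (S : Set Y) :
    ((μ + ν) S : ℝ) = μ S + ν S := by
  rw [FiniteMeasure.coeFn_add, Pi.add_apply, NNReal.coe_add]

theorem coe_smul_apply (c : ℝ≥0) (μ : FiniteMeasure Y) (S : Set Y) :
    ((c • μ) S : ℝ) = c * μ S := by
  rw [FiniteMeasure.coeFn_smul, Pi.smul_apply, smul_eq_mul, NNReal.coe_mul]

theorem coe_mass (μ : FiniteMeasure Y) : (μ.mass : ℝ) = μ Set.univ := rfl

/-- The infimum of two finite measures, with a bound on what it misses of the first one. -/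
theorem exists_inf (μ ν : FiniteMeasure Y) (δ : ℝ)
    (h : ∀ S, MeasurableSet S → (μ S : ℝ) ≤ ν S + δ) :
    ∃ m : FiniteMeasure Y, (m : Measure Y) ≤ μ ∧ (m : Measure Y) ≤ ν ∧
      (μ.mass : ℝ) ≤ m.mass + δ ∧
      ∀ ρ : FiniteMeasure Y, (ρ : Measure Y) ≤ μ → (ρ : Measure Y) ≤ ν →
        (ρ : Measure Y) ≤ m := by
  obtain ⟨s, hs, h₁, h₂⟩ := hahn_decomposition (μ : Measure Y) ν
  have hle : ∀ (α β : FiniteMeasure Y) (t : Set Y), (α : Measure Y) t ≤ (β : Measure Y) t →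
      (α t : ℝ) ≤ β t := by
    intro α β t hαβ
    rwa [← FiniteMeasure.ennreal_coeFn_eq_coeFn_toMeasure,
      ← FiniteMeasure.ennreal_coeFn_eq_coeFn_toMeasure, ENNReal.coe_le_coe,
      ← NNReal.coe_le_coe] at hαβ
  have hsplit : ∀ (α : FiniteMeasure Y) (t : Set Y), (α t : ℝ) = α (t ∩ s) + α (t ∩ sᶜ) := by
    intro α t
    rw [← NNReal.coe_add, NNReal.coe_inj, ← ENNReal.coe_inj, ENNReal.coe_add]
    simp only [FiniteMeasure.ennreal_coeFn_eq_coeFn_toMeasure]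
    rw [← Set.sdiff_eq, measure_inter_add_sdiff t hs]
  have hm : ∀ t, MeasurableSet t →
      ((ν.restrict s + μ.restrict sᶜ) t : ℝ) = ν (t ∩ s) + μ (t ∩ sᶜ) := by
    intro t ht
    rw [coe_add_apply, FiniteMeasure.restrict_apply _ _ ht, FiniteMeasure.restrict_apply _ _ ht]
  have hνμ : ∀ t, MeasurableSet t → (ν (t ∩ s) : ℝ) ≤ μ (t ∩ s) := fun t ht =>
    hle _ _ _ (h₁ _ (ht.inter hs) Set.inter_subset_right)
  have hμν : ∀ t, MeasurableSet t → (μ (t ∩ sᶜ) : ℝ) ≤ ν (t ∩ sᶜ) := fun t ht =>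
    hle _ _ _ (h₂ _ (ht.inter hs.compl) Set.inter_subset_right)
  -- On the Hahn set `s` one has ν ≤ μ, off it μ ≤ ν. The mass missed is μ(s) - ν(s) ≤ δ.
  refine ⟨ν.restrict s + μ.restrict sᶜ, ?_, ?_, ?_, ?_⟩
  · refine toMeasure_le_iff.2 fun t ht => ?_
    rw [hm t ht, hsplit μ t]
    linarith [hνμ t ht]
  · refine toMeasure_le_iff.2 fun t ht => ?_
    rw [hm t ht, hsplit ν t]
    linarith [hμν t ht]
  · rw [coe_mass, coe_mass, hm _ MeasurableSet.univ, hsplit μ Set.univ]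
    have := h s hs
    simp only [Set.univ_inter]
    linarith
  · intro ρ hρμ hρν
    refine toMeasure_le_iff.2 fun t ht => ?_
    rw [hm t ht, hsplit ρ t]
    exact add_le_add (toMeasure_le_iff.1 hρν _ (ht.inter hs))
      (toMeasure_le_iff.1 hρμ _ (ht.inter hs.compl))

/-- Shrinking the heavier of two measures with bounded ratio to the mass of the other one. -/
theorem exists_shrink {μ ν : FiniteMeasure Y} {e : ℝ≥0} (he : 1 ≤ e)
    (h₁ : (μ : Measure Y) ≤ (e • ν : FiniteMeasure Y))
    (h₂ : (ν : Measure Y) ≤ (e • μ : FiniteMeasure Y)) (hmass : ν.mass ≤ μ.mass) :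
    ∃ μ' : FiniteMeasure Y, (μ' : Measure Y) ≤ μ ∧
      (μ' : Measure Y) ≤ (e • ν : FiniteMeasure Y) ∧
      (ν : Measure Y) ≤ (e • μ' : FiniteMeasure Y) ∧ μ'.mass = ν.mass := by
  rcases hmass.eq_or_lt with heq | hlt
  · exact ⟨μ, le_rfl, h₁, h₂, heq.symm⟩
  have heR : (1 : ℝ) ≤ e := by exact_mod_cast he
  have he0 : (0 : ℝ) < e := by linarith
  have hltR : (ν.mass : ℝ) < μ.mass := by exact_mod_cast hlt
  have hν0 : (0 : ℝ) ≤ ν.mass := NNReal.coe_nonneg _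
  have hden : 0 < e * μ.mass - (ν.mass : ℝ) := by nlinarith
  -- The witness is t μ + (1 - t) ν/e. Both μ and ν/e satisfy the order constraints, hence so does
  -- the mixture; t is fixed by the mass equation.
  set t : ℝ := (e - 1) * ν.mass / (e * μ.mass - ν.mass) with ht
  have ht0 : 0 ≤ t := div_nonneg (mul_nonneg (by linarith) hν0) hden.le
  have ht1 : t ≤ 1 := by
    rw [ht, div_le_one hden]
    nlinarith
  have hteq : t * (e * μ.mass - ν.mass) = (e - 1) * ν.mass := div_mul_cancel₀ _ hden.ne'
  have hval : ∀ S, ((t.toNNReal • μ + ((1 - t) / e).toNNReal • ν : FiniteMeasure Y) S : ℝ) =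
      t * μ S + (1 - t) / e * ν S := by
    intro S
    rw [coe_add_apply, coe_smul_apply, coe_smul_apply, Real.coe_toNNReal _ ht0,
      Real.coe_toNNReal _ (div_nonneg (by linarith) he0.le)]
  have hμν := toMeasure_le_iff.1 h₁
  have hνμ := toMeasure_le_iff.1 h₂
  simp only [coe_smul_apply] at hμν hνμ
  have hν' : ∀ S, (1 - t) / e * ν S = (1 - t) * (ν S / e : ℝ) := fun S => by ring
  refine ⟨t.toNNReal • μ + ((1 - t) / e).toNNReal • ν, toMeasure_le_iff.2 fun S hS => ?_,
    toMeasure_le_iff.2 fun S hS => ?_, toMeasure_le_iff.2 fun S hS => ?_, ?_⟩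
  · rw [hval, hν']
    have h3 : (ν S / e : ℝ) ≤ μ S := by
      rw [div_le_iff₀ he0, mul_comm]; exact hνμ S hS
    nlinarith
  · rw [coe_smul_apply, hval, hν']
    have h3 : (ν S / e : ℝ) ≤ e * ν S := by
      rw [div_le_iff₀ he0]
      have : (0 : ℝ) ≤ ν S := NNReal.coe_nonneg _
      nlinarith [mul_le_mul heR heR zero_le_one he0.le]
    nlinarith [hμν S hS]
  · rw [coe_smul_apply, hval]
    have : (e : ℝ) * (t * μ S + (1 - t) / e * ν S) = t * (e * μ S) + (1 - t) * ν S := by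
      field_simp
    rw [this]
    nlinarith [hνμ S hS]
  · rw [← NNReal.coe_inj, coe_mass, hval, ← coe_mass, ← coe_mass]
    field_simp
    linarith

/-- The measure μ₁/e lies below both ν and e μ, hence below their infimum ν₁. Truncation therefore
keeps the ratio bound. -/
theorem le_smul_of_isGreatest {μ ν μ₁ ν₁ : FiniteMeasure Y} {e : ℝ≥0} (he : 1 ≤ e)
    (h₁ : (μ₁ : Measure Y) ≤ μ) (h₂ : (μ₁ : Measure Y) ≤ (e • ν : FiniteMeasure Y))
    (hν₁ : ∀ ρ : FiniteMeasure Y, (ρ : Measure Y) ≤ ν →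
      (ρ : Measure Y) ≤ (e • μ : FiniteMeasure Y) → (ρ : Measure Y) ≤ ν₁) :
    (μ₁ : Measure Y) ≤ (e • ν₁ : FiniteMeasure Y) := by
  have heR : (1 : ℝ) ≤ e := by exact_mod_cast he
  have he0 : (0 : ℝ) < e := by linarith
  have h := hν₁ (e⁻¹ • μ₁)
    (toMeasure_le_iff.2 fun S hS => by
      rw [coe_smul_apply, NNReal.coe_inv, inv_mul_le_iff₀ he0, ← coe_smul_apply]
      exact toMeasure_le_iff.1 h₂ S hS)
    (toMeasure_le_iff.2 fun S hS => by
      rw [coe_smul_apply, coe_smul_apply, NNReal.coe_inv, inv_mul_le_iff₀ he0]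
      have h0 : (0 : ℝ) ≤ μ S := NNReal.coe_nonneg _
      have h1 : (1 : ℝ) ≤ e * e := by nlinarith
      nlinarith [toMeasure_le_iff.1 h₁ S hS])
  refine toMeasure_le_iff.2 fun S hS => ?_
  have := toMeasure_le_iff.1 h S hS
  rwa [coe_smul_apply, NNReal.coe_inv, inv_mul_le_iff₀ he0, ← coe_smul_apply] at this

/-- Two probability measures that are close in the sense of approximate differential privacy
dominate the two outputs of binary randomized response, up to mass `δ`. -/
theorem exists_randomizedResponse {P Q : FiniteMeasure Y} (hP : P.mass = 1) (hQ : Q.mass = 1)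
    {e : ℝ≥0} (he : 1 ≤ e) {δ : ℝ}
    (hPQ : ∀ S, MeasurableSet S → (P S : ℝ) ≤ e * Q S + δ)
    (hQP : ∀ S, MeasurableSet S → (Q S : ℝ) ≤ e * P S + δ) :
    ∃ q₀ q₁ : FiniteMeasure Y, q₀.mass ≤ 1 ∧ q₁.mass ≤ 1 ∧
      (((e / (e + 1)) • q₀ + (1 / (e + 1)) • q₁ : FiniteMeasure Y) : Measure Y) ≤ P ∧
      (((1 / (e + 1)) • q₀ + (e / (e + 1)) • q₁ : FiniteMeasure Y) : Measure Y) ≤ Q ∧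
      1 - δ ≤ q₀.mass ∧ 1 - δ ≤ q₁.mass := by
  have heR : (1 : ℝ) ≤ e := by exact_mod_cast he
  have he0 : (0 : ℝ) < e := by linarith
  obtain ⟨P₁, hP₁P, hP₁Q, hP₁m, hP₁⟩ := exists_inf P (e • Q) δ
    (by simpa only [coe_smul_apply] using hPQ)
  obtain ⟨Q₁, hQ₁Q, hQ₁P, hQ₁m, hQ₁⟩ := exists_inf Q (e • P) δ
    (by simpa only [coe_smul_apply] using hQP)
  rw [hP] at hP₁m
  rw [hQ] at hQ₁m
  have hP₁Q₁ := le_smul_of_isGreatest he hP₁P hP₁Q hQ₁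
  have hQ₁P₁ := le_smul_of_isGreatest he hQ₁Q hQ₁P hP₁
  obtain ⟨P₂, Q₂, hP₂, hQ₂, hPQ₂, hQP₂, hm, hm1⟩ : ∃ P₂ Q₂ : FiniteMeasure Y,
      (P₂ : Measure Y) ≤ P ∧ (Q₂ : Measure Y) ≤ Q ∧
      (P₂ : Measure Y) ≤ (e • Q₂ : FiniteMeasure Y) ∧
      (Q₂ : Measure Y) ≤ (e • P₂ : FiniteMeasure Y) ∧ P₂.mass = Q₂.mass ∧
      1 - δ ≤ P₂.mass := by
    push_cast at hP₁m hQ₁m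
    rcases le_total Q₁.mass P₁.mass with hle | hle
    · obtain ⟨P₂, h1, h2, h3, h4⟩ := exists_shrink he hP₁Q₁ hQ₁P₁ hle
      exact ⟨P₂, Q₁, h1.trans hP₁P, hQ₁Q, h2, h3, h4, by rw [h4]; linarith⟩
    · obtain ⟨Q₂, h1, h2, h3, h4⟩ := exists_shrink he hQ₁P₁ hP₁Q₁ hle
      exact ⟨P₁, Q₂, hP₁P, h1.trans hQ₁Q, h3, h2, h4.symm, by linarith⟩
  have hm2 : P₂.mass ≤ 1 := by
    rw [← hP, ← NNReal.coe_le_coe]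
    exact toMeasure_le_iff.1 hP₂ _ MeasurableSet.univ
  have hP₂' := toMeasure_le_iff.1 hP₂
  have hQ₂' := toMeasure_le_iff.1 hQ₂
  -- For e = 1 the 2×2 system for q₀, q₁ is singular, but then P₂ = Q₂ serves for both.
  rcases he.eq_or_lt with rfl | hlt
  · rw [one_smul] at hPQ₂ hQP₂
    obtain rfl : P₂ = Q₂ := FiniteMeasure.toMeasure_injective (le_antisymm hPQ₂ hQP₂)
    refine ⟨P₂, P₂, hm2, hm2, toMeasure_le_iff.2 fun S hS => ?_,
      toMeasure_le_iff.2 fun S hS => ?_, hm1, hm1⟩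
    · rw [coe_add_apply, coe_smul_apply]
      push_cast
      linarith [hP₂' S hS]
    · rw [coe_add_apply, coe_smul_apply]
      push_cast
      linarith [hQ₂' S hS]
  · have hltR : (1 : ℝ) < e := by exact_mod_cast hlt
    have hd : (0 : ℝ) < e - 1 := by linarith
    have hd' : ((e - 1 : ℝ≥0) : ℝ) = e - 1 := by rw [NNReal.coe_sub he, NNReal.coe_one]
    -- Inverting the system gives q₀ = (e P₂ - Q₂)/(e - 1) and q₁ = (e Q₂ - P₂)/(e - 1). The ratio
    -- bounds make them nonnegative, and equal masses of P₂, Q₂ give them that same mass.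
    obtain ⟨z₁, hz₁⟩ := exists_add_eq_of_le hPQ₂
    obtain ⟨z₀, hz₀⟩ := exists_add_eq_of_le hQP₂
    have hz₁' : ∀ S, (z₁ S : ℝ) = e * Q₂ S - P₂ S := fun S => by
      have := coe_add_apply P₂ z₁ S
      rw [hz₁, coe_smul_apply] at this
      linarith
    have hz₀' : ∀ S, (z₀ S : ℝ) = e * P₂ S - Q₂ S := fun S => by
      have := coe_add_apply Q₂ z₀ S
      rw [hz₀, coe_smul_apply] at this
      linarith
    have hmR : (P₂ Set.univ : ℝ) = Q₂ Set.univ := by exact_mod_cast hm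
    have hm₀ : ((e - 1)⁻¹ • z₀).mass = P₂.mass := by
      rw [← NNReal.coe_inj, coe_mass, coe_mass, coe_smul_apply, NNReal.coe_inv, hd', hz₀',
        ← hmR]
      field_simp
    have hm₁ : ((e - 1)⁻¹ • z₁).mass = P₂.mass := by
      rw [← NNReal.coe_inj, coe_mass, coe_mass, coe_smul_apply, NNReal.coe_inv, hd', hz₁',
        ← hmR]
      field_simp
    refine ⟨(e - 1)⁻¹ • z₀, (e - 1)⁻¹ • z₁, hm₀ ▸ hm2, hm₁ ▸ hm2,
      toMeasure_le_iff.2 fun S hS => ?_, toMeasure_le_iff.2 fun S hS => ?_, hm₀ ▸ hm1, hm₁ ▸ hm1⟩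
    · refine le_of_eq_of_le ?_ (hP₂' S hS)
      simp only [coe_add_apply, coe_smul_apply, NNReal.coe_inv, NNReal.coe_div, NNReal.coe_add,
        NNReal.coe_one, hd', hz₀', hz₁']
      field_simp
      ring
    · refine le_of_eq_of_le ?_ (hQ₂' S hS)
      simp only [coe_add_apply, coe_smul_apply, NNReal.coe_inv, NNReal.coe_div, NNReal.coe_add,
        NNReal.coe_one, hd', hz₀', hz₁']
      field_simp
      ring

/-- Splitting a component `W` off a probability measure `R` that almost dominates it. -/
theorem exists_remainder {R W : FiniteMeasure Y} (hR : R.mass = 1) {c : ℝ≥0} (hc : c ≤ 1)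
    {η : ℝ≥0} (hW : ∀ S, MeasurableSet S → (W S : ℝ) ≤ R S + η) (hWc : (c : ℝ) - η ≤ W.mass) :
    ∃ L D D' : FiniteMeasure Y, L.mass ≤ 1 - c ∧
      (R : Measure Y) ≤ (W + L + D : FiniteMeasure Y) ∧ D.mass ≤ 2 * η ∧
      ((W + L : FiniteMeasure Y) : Measure Y) ≤ (R + D' : FiniteMeasure Y) ∧ D'.mass ≤ η := by
  obtain ⟨m, hmW, hmR, hmass, -⟩ := exists_inf W R η hW
  obtain ⟨D', hD'⟩ := exists_add_eq_of_le hmW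
  obtain ⟨K, hK⟩ := exists_add_eq_of_le hmR
  have hWS : ∀ S, (W S : ℝ) = m S + D' S := fun S => by rw [← hD', coe_add_apply]
  have hRS : ∀ S, (R S : ℝ) = m S + K S := fun S => by rw [← hK, coe_add_apply]
  have hRm : (m.mass : ℝ) + K.mass = 1 := by
    have := hRS Set.univ
    rw [← coe_mass, hR] at this
    exact this.symm
  have hWm : (W.mass : ℝ) = m.mass + D'.mass := hWS Set.univ
  have hD'm : D'.mass ≤ η := by
    rw [← NNReal.coe_le_coe]; linarith
  have hKm : K.mass ≤ (1 - c) + 2 * η := by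
    rw [← NNReal.coe_le_coe]
    push_cast [NNReal.coe_sub hc]
    linarith
  -- The leftover K may exceed mass 1 - c by up to 2η; scaling by s makes it fit, and the excess
  -- goes into D.
  have hs : ∃ s : ℝ≥0, s ≤ 1 ∧ s * K.mass ≤ 1 - c ∧ (1 - s) * K.mass ≤ 2 * η := by
    by_cases hle : K.mass ≤ 1 - c
    · exact ⟨1, le_rfl, by simpa using hle, by simp⟩
    · have hlt := not_le.1 hle
      have hK0 : 0 < K.mass := zero_le.trans_lt hlt
      refine ⟨(1 - c) / K.mass, ?_, ?_, ?_⟩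
      · exact div_le_one_of_le₀ hlt.le zero_le
      · rw [div_mul_cancel₀ _ hK0.ne']
      · rw [tsub_mul, div_mul_cancel₀ _ hK0.ne', one_mul, tsub_le_iff_left]
        exact hKm
  obtain ⟨s, hs1, hsL, hsD⟩ := hs
  have hs1R : (s : ℝ) ≤ 1 := by exact_mod_cast hs1
  have hmassmul : ∀ t : ℝ≥0, (t • K).mass = t * K.mass := fun t => by
    rw [← NNReal.coe_inj, coe_mass, coe_smul_apply, NNReal.coe_mul, coe_mass]
  refine ⟨s • K, (1 - s) • K, D', by rwa [hmassmul], toMeasure_le_iff.2 fun S hS => ?_,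
    by rwa [hmassmul], toMeasure_le_iff.2 fun S hS => ?_, hD'm⟩
  · simp only [coe_add_apply, coe_smul_apply, NNReal.coe_sub hs1, NNReal.coe_one, hWS, hRS]
    have : (0 : ℝ) ≤ D' S := NNReal.coe_nonneg _
    linarith
  · simp only [coe_add_apply, coe_smul_apply, hWS, hRS]
    have : (0 : ℝ) ≤ K S := NNReal.coe_nonneg _
    nlinarith

end Decomposition

/-! ### Amplification with approximate local privacy -/

theorem DPBound.coe_le {Y : Type*} [MeasurableSpace Y] {P Q : FiniteMeasure Y} {ε δ : ℝ}
    (hδ : 0 ≤ δ) (h : DPBound ε δ (P : Measure Y) (Q : Measure Y)) (S : Set Y)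
    (hS : MeasurableSet S) : (P S : ℝ) ≤ Real.exp ε * Q S + δ := by
  have h' := h S hS
  rw [← FiniteMeasure.ennreal_coeFn_eq_coeFn_toMeasure,
    ← FiniteMeasure.ennreal_coeFn_eq_coeFn_toMeasure, ENNReal.ofReal, ENNReal.ofReal] at h'
  norm_cast at h'
  rw [← NNReal.coe_le_coe] at h'
  push_cast at h'
  rwa [Real.coe_toNNReal _ (Real.exp_pos ε).le, Real.coe_toNNReal _ hδ] at h'

/-- Averaging the bounds for P and Q gives (q₀ + q₁)/2 ≤ e R + δ; dividing by e shows that R almost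
dominates the clone component, with error δ/e. -/
theorem exists_clone_remainder {Y : Type*} [MeasurableSpace Y] {P Q R q₀ q₁ : FiniteMeasure Y}
    (hR : R.mass = 1) {e : ℝ≥0} (he : 1 ≤ e) {δ : ℝ≥0}
    (hq : ∀ T, MeasurableSet T → (q₀ T + q₁ T : ℝ) ≤ P T + Q T)
    (hq₀ : 1 - (δ : ℝ) ≤ q₀.mass) (hq₁ : 1 - (δ : ℝ) ≤ q₁.mass)
    (hP : ∀ T, MeasurableSet T → (P T : ℝ) ≤ e * R T + δ)
    (hQ : ∀ T, MeasurableSet T → (Q T : ℝ) ≤ e * R T + δ) :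
    ∃ L D D' : FiniteMeasure Y, L.mass ≤ 1 - e⁻¹ ∧
      (R : Measure Y) ≤ ((e⁻¹ / 2) • (q₀ + q₁) + L + D : FiniteMeasure Y) ∧
      D.mass ≤ 2 * (e⁻¹ * δ) ∧
      (((e⁻¹ / 2) • (q₀ + q₁) + L : FiniteMeasure Y) : Measure Y) ≤
        (R + D' : FiniteMeasure Y) ∧ D'.mass ≤ e⁻¹ * δ := by
  have he0 : (0 : ℝ) < e := zero_lt_one.trans_le (by exact_mod_cast he)
  refine exists_remainder hR (inv_le_one_of_one_le₀ he) (fun T hT => ?_) ?_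
  · rw [coe_smul_apply, coe_add_apply]
    push_cast
    have h1 : (q₀ T + q₁ T : ℝ) ≤ 2 * (e * R T + δ) := by
      linarith [hq T hT, hP T hT, hQ T hT]
    calc ((e : ℝ)⁻¹ / 2) * (q₀ T + q₁ T) ≤ (e : ℝ)⁻¹ / 2 * (2 * (e * R T + δ)) := by gcongr
      _ = R T + (e : ℝ)⁻¹ * δ := by field_simp
  · rw [coe_mass, coe_smul_apply, coe_add_apply, ← coe_mass, ← coe_mass]
    push_cast
    have : ((e : ℝ)⁻¹ / 2) * (2 - 2 * δ) ≤ (e : ℝ)⁻¹ / 2 * (q₀.mass + q₁.mass) := by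
      gcongr
      linarith
    linarith

theorem mass_clone_add_le {Y : Type*} [MeasurableSpace Y] {q₀ q₁ L : FiniteMeasure Y} {c : ℝ≥0}
    (hc : c ≤ 1) (hq₀ : q₀.mass ≤ 1) (hq₁ : q₁.mass ≤ 1) (hL : L.mass ≤ 1 - c) :
    ((c / 2) • (q₀ + q₁) + L).mass ≤ 1 := by
  rw [← NNReal.coe_le_coe] at *
  rw [NNReal.coe_sub (by exact_mod_cast hc)] at hL
  simp only [coe_mass, coe_add_apply, coe_smul_apply] at *
  push_cast at *
  have : (c / 2 : ℝ) * (q₀ Set.univ + q₁ Set.univ) ≤ c / 2 * 2 := by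
    gcongr
    linarith
  linarith

theorem perturbation_cost_le {c δ : ℝ≥0} {E : ℝ} (hc : c ≤ 1) (hE : 1 ≤ E) :
    ((max 1 (2 * c) * δ : ℝ≥0) : ℝ) + E * (c * δ : ℝ≥0) ≤ (E + 1) * ((c : ℝ) / 2 + 1) * δ := by
  have hc0 : (0 : ℝ) ≤ c := c.coe_nonneg
  have hc1 : (c : ℝ) ≤ 1 := by exact_mod_cast hc
  have hcoef : max 1 (2 * (c : ℝ)) + E * c ≤ (E + 1) * (c / 2 + 1) := by
    rcases max_cases 1 (2 * (c : ℝ)) with ⟨h, -⟩ | ⟨h, -⟩ <;> rw [h] <;> nlinarith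
  push_cast
  linarith [mul_le_mul_of_nonneg_right hcoef δ.coe_nonneg]

/-- Amplification by shuffling for a family of laws in which the one at `i₀` is changed. -/
theorem shuffledMass_amplification {Y : Type*} [MeasurableSpace Y] {n : ℕ}
    (S : Set (Fin n → Y)) (ν ν' : Fin n → FiniteMeasure Y) (i₀ : Fin n)
    (hν : ∀ i, (ν i).mass = 1) (hν' : ∀ i, (ν' i).mass = 1) (heq : ∀ i, i ≠ i₀ → ν i = ν' i)
    (e : ℝ≥0) (he : 1 ≤ e) (δ₀ : ℝ≥0)
    (hP : ∀ i S, MeasurableSet S → (ν i₀ S : ℝ) ≤ e * ν i S + δ₀)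
    (hQ : ∀ i S, MeasurableSet S → (ν' i₀ S : ℝ) ≤ e * ν i S + δ₀)
    (hPQ : ∀ S, MeasurableSet S → (ν i₀ S : ℝ) ≤ e * ν' i₀ S + δ₀)
    (l r : ℝ) (hl : Real.log 2 ≤ l) (hlN : 16 * l ≤ n / e)
    (hr : 8 * Real.sqrt (l / (n / e)) + 8 / (n / e) ≤ r) :
    (shuffledMass S ν : ℝ) ≤ (1 + (e - 1) / (e + 1) * r) * shuffledMass S ν' +
      2 * Real.exp (-l) +
      ((1 + (e - 1) / (e + 1) * r) + 1) * ((e : ℝ)⁻¹ / 2 + 1) * n * δ₀ := by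
  have heR : (1 : ℝ) ≤ e := by exact_mod_cast he
  have he0 : (0 : ℝ) < e := by linarith
  set c : ℝ≥0 := e⁻¹ with hc
  have hc1 : c ≤ 1 := inv_le_one_of_one_le₀ he
  set a : ℝ≥0 := e / (e + 1) with ha
  set b : ℝ≥0 := 1 / (e + 1) with hb
  have hab1 : a + b = 1 := by rw [ha, hb, ← add_div, div_self (by positivity)]
  have hab1R : (a : ℝ) + b = 1 := by exact_mod_cast hab1
  have hba : b ≤ a := by rw [ha, hb]; gcongr
  have hsub : (a : ℝ) - b = (e - 1) / (e + 1) := by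
    rw [ha, hb]; push_cast; ring
  obtain ⟨q₀, q₁, hq₀, hq₁, hqP, hqQ, hm₀, hm₁⟩ :=
    exists_randomizedResponse (hν i₀) (hν' i₀) he hPQ (hQ i₀)
  have hq : ∀ T, MeasurableSet T → (q₀ T + q₁ T : ℝ) ≤ ν i₀ T + ν' i₀ T := fun T hT => by
    have h1 := toMeasure_le_iff.1 hqP T hT
    have h2 := toMeasure_le_iff.1 hqQ T hT
    simp only [coe_add_apply, coe_smul_apply] at h1 h2
    linear_combination h1 + h2 - (q₀ T + q₁ T : ℝ) * hab1R
  set η : ℝ≥0 := c * δ₀ with hη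
  have hrem : ∀ i, ∃ L D D' : FiniteMeasure Y, L.mass ≤ 1 - c ∧
      (ν i : Measure Y) ≤ ((c / 2) • (q₀ + q₁) + L + D : FiniteMeasure Y) ∧ D.mass ≤ 2 * η ∧
      (((c / 2) • (q₀ + q₁) + L : FiniteMeasure Y) : Measure Y) ≤
        (ν i + D' : FiniteMeasure Y) ∧ D'.mass ≤ η := by
    exact fun i => exists_clone_remainder (hν i) he hq hm₀ hm₁ (hP i) (hQ i)
  choose L D D' hL hD hDm hD' hD'm using hrem
  set W : Fin n → FiniteMeasure Y := fun i => (c / 2) • (q₀ + q₁) + L i with hWdef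
  have hWm : ∀ i, (W i).mass ≤ 1 := fun i => mass_clone_add_le hc1 hq₀ hq₁ (hL i)
  obtain ⟨D₀, hD₀⟩ := exists_add_eq_of_le hqP
  have hD₀m : (D₀.mass : ℝ) ≤ δ₀ := by
    have h1 : (D₀.mass : ℝ) = 1 - (a * q₀.mass + b * q₁.mass) := by
      have := coe_add_apply (a • q₀ + b • q₁) D₀ Set.univ
      rw [hD₀, ← coe_mass, hν i₀, coe_add_apply, coe_smul_apply, coe_smul_apply] at this
      simp only [← coe_mass, NNReal.coe_one] at this
      linarith
    have h2 : (a : ℝ) * (1 - δ₀) ≤ a * q₀.mass := by gcongr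
    have h3 : (b : ℝ) * (1 - δ₀) ≤ b * q₁.mass := by gcongr
    have h4 : (a : ℝ) * (1 - δ₀) + b * (1 - δ₀) = 1 - δ₀ := by rw [← add_mul, hab1R, one_mul]
    linarith
  have hsubP : (a • q₀ + b • q₁).mass ≤ 1 := by
    rw [← hν i₀, ← NNReal.coe_le_coe]
    exact toMeasure_le_iff.1 hqP _ MeasurableSet.univ
  have hsubQ : (b • q₀ + a • q₁).mass ≤ 1 := by
    rw [← hν' i₀, ← NNReal.coe_le_coe]
    exact toMeasure_le_iff.1 hqQ _ MeasurableSet.univ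
  -- A common bound for the defect δ₀ at `i₀` and the defects 2cδ₀ elsewhere.
  set t : ℝ≥0 := max 1 (2 * c) * δ₀ with ht
  have hupd : ∀ z : FiniteMeasure Y, z.mass ≤ 1 → ∀ i, (Function.update W i₀ z i).mass ≤ 1 := by
    intro z hz i
    by_cases hi : i = i₀
    · subst hi; rwa [Function.update_self]
    · rw [Function.update_of_ne hi]; exact hWm i
  have hfirst : shuffledMass S ν ≤
      shuffledMass S (Function.update W i₀ (a • q₀ + b • q₁)) + n * t := by
    refine (shuffledMass_le_add S ν _ (Function.update D i₀ D₀) (fun i => (hν i).le)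
      (hupd _ hsubP) fun i => ?_).trans (add_le_add_right ?_ _)
    · by_cases hi : i = i₀
      · subst hi
        rw [Function.update_self, Function.update_self, hD₀]
      · rw [Function.update_of_ne hi, Function.update_of_ne hi]
        exact hD i
    · refine (sum_le_card_nsmul univ _ t fun i _ => ?_).trans ?_
      · by_cases hi : i = i₀
        · subst hi
          rw [Function.update_self]
          have h1 : D₀.mass ≤ δ₀ := by exact_mod_cast hD₀m
          exact h1.trans (le_mul_of_one_le_left zero_le (le_max_left _ _))
        · rw [Function.update_of_ne hi]
          refine (hDm i).trans ?_
          rw [hη, ← mul_assoc, ht]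
          gcongr
          exact le_max_right _ _
      · rw [card_univ, Fintype.card_fin, nsmul_eq_mul]
  -- On the way back there is no defect at `i₀`, where the mixture lies below the true law.
  have hlast : shuffledMass S (Function.update W i₀ (b • q₀ + a • q₁)) ≤
      shuffledMass S ν' + n * η := by
    refine (shuffledMass_le_add S _ ν' (Function.update D' i₀ 0) (hupd _ hsubQ)
      (fun i => (hν' i).le) fun i => ?_).trans (add_le_add_right ?_ _)
    · by_cases hi : i = i₀
      · subst hi
        rw [Function.update_self, Function.update_self, add_zero]
        exact hqQ
      · rw [Function.update_of_ne hi, Function.update_of_ne hi, ← heq i hi]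
        exact hD' i
    · refine (sum_le_card_nsmul univ _ η fun i _ => ?_).trans ?_
      · by_cases hi : i = i₀
        · subst hi
          rw [Function.update_self, FiniteMeasure.zero_mass]
          exact zero_le
        · rw [Function.update_of_ne hi]
          exact hD'm i
      · rw [card_univ, Fintype.card_fin, nsmul_eq_mul]
  have hN : (n : ℝ) / e = c * Fintype.card (Fin n) := by
    rw [Fintype.card_fin, hc, NNReal.coe_inv, div_eq_inv_mul]
  have hmid := clone_amplification (shuffledMass S) FiniteMeasure.mass
    (shuffledMass_comp_perm S) (shuffledMass_le S) i₀ q₀ q₁ hq₀ hq₁ L c hc1 hL a b hba hab1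
    l r (n / e) hN hl hlN hr
  have hr0 : 0 ≤ r := le_trans (by positivity) hr
  rw [hsub] at hmid
  have hfac : 0 ≤ ((e : ℝ) - 1) / (e + 1) * r :=
    mul_nonneg (div_nonneg (by linarith) (by linarith)) hr0
  set E : ℝ := 1 + ((e : ℝ) - 1) / (e + 1) * r with hE
  have hE1 : 1 ≤ E := by linarith
  have hfirstR : (shuffledMass S ν : ℝ) ≤
      shuffledMass S (Function.update W i₀ (a • q₀ + b • q₁)) + n * t := by
    exact_mod_cast hfirst
  have hlastR : (shuffledMass S (Function.update W i₀ (b • q₀ + a • q₁)) : ℝ) ≤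
      shuffledMass S ν' + n * η := by
    exact_mod_cast hlast
  have hcost : (t : ℝ) + E * η ≤ (E + 1) * ((e : ℝ)⁻¹ / 2 + 1) * δ₀ := by
    rw [ht, hη, ← NNReal.coe_inv, ← hc]
    exact perturbation_cost_le hc1 hE1
  have hcost' := mul_le_mul_of_nonneg_left hcost (Nat.cast_nonneg n : (0 : ℝ) ≤ n)
  have hlast' := mul_le_mul_of_nonneg_left hlastR (by linarith : 0 ≤ E)
  linarith

end Safhire

/-! ### Choice of parameters -/

theorem mainTheorem1 {X Y : Type*} [MeasurableSpace Y]
    (R : X → Measure Y) [∀ x, IsProbabilityMeasure (R x)]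
    (n : ℕ) (hn : 1 ≤ n) (ε₀ δ₀ : ℝ) (hε₀ : 0 ≤ ε₀) (hδ₀ : 0 ≤ δ₀)
    (hR : Safhire.IsLocallyDP R ε₀ δ₀)
    (δ : ℝ) (hδ_pos : 0 < δ) (hδ_le : δ ≤ 1)
    (hn_large : ε₀ ≤ Real.log (n / (16 * Real.log (2 / δ)))) :
    ∃ ε : ℝ, 0 ≤ ε ∧
      ε ≤ Real.log (1 + (Real.exp ε₀ - 1) / (Real.exp ε₀ + 1) *
        (8 * Real.sqrt (Real.exp ε₀ * Real.log (4 / δ)) / Real.sqrt n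
          + 8 * Real.exp ε₀ / n)) ∧
      Safhire.IsDP (fun x : Fin n → X => Safhire.clientView R x) ε
        (δ + (Real.exp ε + 1) * (Real.exp (-ε₀) / 2 + 1) * n * δ₀) := by
  have hn0 : (0 : ℝ) < n := by exact_mod_cast hn
  have he1 : 1 ≤ Real.exp ε₀ := Real.one_le_exp hε₀
  have he0 : 0 < Real.exp ε₀ := Real.exp_pos _
  set l : ℝ := Real.log (2 / δ) with hl
  have hl2 : Real.log 2 ≤ l :=
    Real.log_le_log two_pos (by rw [le_div_iff₀ hδ_pos]; linarith)
  have hl0 : 0 < l := (Real.log_pos one_lt_two).trans_le hl2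
  -- The argument runs with ln(2/δ); the stated ln(4/δ) enters only through this monotonicity.
  have hl4 : l ≤ Real.log (4 / δ) := Real.log_le_log (by positivity) (by gcongr; norm_num)
  have hexpl : 2 * Real.exp (-l) = δ := by
    rw [hl, Real.exp_neg, Real.exp_log (by positivity)]
    field_simp
  have hlN : 16 * l ≤ n / Real.exp ε₀ := by
    rw [Real.le_log_iff_exp_le (by positivity), le_div_iff₀ (by positivity)] at hn_large
    rw [le_div_iff₀ he0]
    linarith
  set r : ℝ := 8 * Real.sqrt (Real.exp ε₀ * Real.log (4 / δ)) / Real.sqrt n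
    + 8 * Real.exp ε₀ / n with hr
  have hr0 : 0 ≤ r := by positivity
  have hrle : 8 * Real.sqrt (l / (n / Real.exp ε₀)) + 8 / (n / Real.exp ε₀) ≤ r := by
    rw [hr, mul_div_assoc 8 (Real.sqrt _), ← Real.sqrt_div' _ hn0.le]
    refine add_le_add ?_ (le_of_eq ?_)
    · have h : l / (n / Real.exp ε₀) = Real.exp ε₀ * l / n := by
        rw [div_div_eq_mul_div, mul_comm]
      rw [h]
      gcongr
    · rw [div_div_eq_mul_div]
  have hfac : 0 ≤ (Real.exp ε₀ - 1) / (Real.exp ε₀ + 1) * r :=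
    mul_nonneg (div_nonneg (by linarith) (by linarith)) hr0
  -- The witness is the upper bound itself.
  refine ⟨Real.log (1 + (Real.exp ε₀ - 1) / (Real.exp ε₀ + 1) * r),
    Real.log_nonneg (by linarith), le_rfl, ?_⟩
  rw [Real.exp_log (by linarith)]
  rintro x x' ⟨i₀, hx⟩ S -
  let law : X → FiniteMeasure Y := fun z => ⟨R z, inferInstance⟩
  have hlaw : ∀ z, (law z).mass = 1 := fun z => by
    rw [← ENNReal.coe_inj, FiniteMeasure.ennreal_mass]
    exact measure_univ (μ := R z)
  have hview : ∀ z : Fin n → X, Safhire.clientView R z S =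
      (Safhire.shuffledMass S (fun i => law (z i)) : ENNReal) := fun z =>
    (Safhire.coe_shuffledMass S fun i => law (z i)).symm
  have hldp : ∀ z z' S, MeasurableSet S →
      (law z S : ℝ) ≤ (Real.exp ε₀).toNNReal * law z' S + δ₀.toNNReal := by
    intro z z' S hS
    rw [Real.coe_toNNReal _ he0.le, Real.coe_toNNReal _ hδ₀]
    exact Safhire.DPBound.coe_le (P := law z) (Q := law z') hδ₀ (hR z z') S hS
  have key := Safhire.shuffledMass_amplification S (fun i => law (x i)) (fun i => law (x' i)) i₀
    (fun i => hlaw _) (fun i => hlaw _) (fun i hi => by rw [hx i hi])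
    (Real.exp ε₀).toNNReal (by rwa [Real.one_le_toNNReal]) δ₀.toNNReal
    (fun i => hldp _ _) (fun i => hldp _ _) (hldp _ _) l r hl2
    (by rwa [Real.coe_toNNReal _ he0.le]) (by rwa [Real.coe_toNNReal _ he0.le])
  rw [Real.coe_toNNReal _ he0.le, Real.coe_toNNReal _ hδ₀, hexpl, ← Real.exp_neg, add_assoc] at key
  simp only [hview]
  rw [Real.exp_log (by linarith)]
  set E : ℝ := 1 + (Real.exp ε₀ - 1) / (Real.exp ε₀ + 1) * r with hE
  rw [← ENNReal.ofReal_coe_nnreal, ← ENNReal.ofReal_coe_nnreal,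
    ← ENNReal.ofReal_mul (by linarith), ← ENNReal.ofReal_add (by positivity) (by positivity)]
  exact ENNReal.ofReal_le_ofReal key
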